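/- Let $B$ be a unital algebra over $\mathbb{C}$. A $B$-$B$-non-commutative probability space is a triple $(\mathcal{A},E,\varepsilon)$ where $\mathcal{A}$ is a unital algebra, $\varepsilon : B\otimes B^{\mathrm{op}}\to\mathcal{A}$ is a unital homomorphism that is injective on $B\otimes 1_B$ and on $1_B\otimes B^{\mathrm{op}}$, and $E:\mathcal{A}\to B$ is a linear map with $E(\varepsilon(b_1\otimes b_2)Z)=b_1E(Z)b_2$ and $E(Z\varepsilon(b\otimes 1))=E(Z\varepsilon(1\otimes b))$ for all $b,b_1,b_2\in B$ and $Z\in\mathcal{A}$. Write $L_b=\varepsilon(b\otimes 1)$, $R_b=\varepsilon(1\otimes b)$, and let $\mathcal{A}_\ell$ (respectively $\mathcal{A}_r$) be the algebra of the elements of $\mathcal{A}$ that commute with every $R_b$ (respectively every $L_b$). For $\chi:\{1,\dots,n\}\to\{\ell,r\}$ let $\prec_\chi$ be the total order on $\{1,\dots,n\}$ that lists $\chi^{-1}(\ell)$ increasingly and then $\chi^{-1}(r)$ decreasingly, let $BNC(\chi)$ be the set of partitions of $\{1,\dots,n\}$ that are non-crossing with respect to $\prec_\chi$, ordered by refinement,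 with Möbius function $\mu_{BNC}$ and largest element $1_\chi$. The moment function $E^B_\pi(Z_1,\dots,Z_n)\in B$, for $\pi\in BNC(\chi)$ and $Z_k\in\mathcal{A}_{\chi(k)}$, is the bi-multiplicative function with $E^B_{1_\chi}(Z_1,\dots,Z_n)=E(Z_1\cdots Z_n)$. It is computed by the following reduction, also for $\pi$ a non-crossing partition of a subset of the nodes. If $\pi$ has at least two blocks, let $V$ be the block whose $\prec_\chi$-last node comes first among the $\prec_\chi$-last nodes of all blocks, let $W$ be the union of the other blocks, and let $b=E(\prod_{k\in V}Z_k)$, the product being in increasing order of $k$. If no node of $W$ precedes $V$, then $E^B_\pi(Z)=b\,E^B_{\pi|_W}(Z|_W)$. Otherwise $E^B_\pi(Z)=E^B_{\pi|_W}(Z'|_W)$, where $Z'$ arises from $Z$ by replacing $Z_p$, for $p$ the $\prec_\chi$-last node of $W$ that precedes $V$, by $Z_pL_b$ if $\chi(p)=\ell$ and by $R_bZ_p$ if $\chi(p)=r$. The cumulants are $$\kappa^B_\chi(Z_1,\dots,Z_n)=\sum_{\sigma\in BNC(\chi)}\mu_{BNC}(\sigma,1_\chi)\,E^B_\sigma(Z_1,\dots,Z_n).$$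 Let $Z=\{Z_i\}_{i\in I}\sqcup\{Z_j\}_{j\in J}$ with $Z_i\in\mathcal{A}_\ell$ and $Z_j\in\mathcal{A}_r$, let $n\ge 1$ and $\omega:\{1,\dots,n\}\to I\sqcup J$, and put $\chi_\omega(k)=\ell$ if $\omega(k)\in I$ and $\chi_\omega(k)=r$ if $\omega(k)\in J$. Write $C^{k}_b=L_b$ if $\omega(k)\in I$ and $C^{k}_b=R_b$ if $\omega(k)\in J$. If $\omega$ takes values only in $I$ or only in $J$, define $$\kappa^B_{Z,\omega}(b_1,\dots,b_{n-1})=\kappa^B_{\chi_\omega}\big(Z_{\omega(1)},C^{2}_{b_1}Z_{\omega(2)},\dots,C^{n}_{b_{n-1}}Z_{\omega(n)}\big).$$ Otherwise let $k_0$ be the first index with $\chi_\omega(k_0)\ne\chi_\omega(1)$, and define $\kappa^B_{Z,\omega}(b_1,\dots,b_{n-1})$ as $\kappa^B_{\chi_\omega}$ of the tuple whose entries are $Z_{\omega(1)}$ at position $1$, $C^{k}_{b_{k-1}}Z_{\omega(k)}$ for $1<k<k_0$, $Z_{\omega(k_0)}$ at position $k_0$, and $C^{k}_{b_{k-2}}Z_{\omega(k)}$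 for $k>k_0$, where in addition the last entry is multiplied on the right by $C^{n}_{b_{n-1}}$. **Theorem.** Let $(\mathcal{A},E,\varepsilon)$ be a $B$-$B$-non-commutative probability space, let $D\subseteq B$ be a subalgebra with $1_B\in D$, and let $F:B\to D$ be a conditional expectation, that is, a linear map with $F(d)=d$ and $F(d_1bd_2)=d_1F(b)d_2$ for all $d,d_1,d_2\in D$ and $b\in B$. Let $\kappa^D$ denote the cumulants of the $D$-$D$-non-commutative probability space $(\mathcal{A},F\circ E,\varepsilon|_{D\otimes D^{\mathrm{op}}})$. Let $\{Z_i\}_{i\in I}\subseteq\mathcal{A}_\ell$ and $\{Z_j\}_{j\in J}\subseteq\mathcal{A}_r$. If $$\kappa^B_{Z,\omega}(d_1,\dots,d_{n-1})\in D$$ for all $n\ge1$, $\omega:\{1,\dots,n\}\to I\sqcup J$ and $d_1,\dots,d_{n-1}\in D$, then $$\kappa^D_{Z,\omega}(d_1,\dots,d_{n-1})=\kappa^B_{Z,\omega}(d_1,\dots,d_{n-1})$$ for all $n\ge1$, $\omega:\{1,\dots,n\}\to I\sqcup J$ and $d_1,\dots,d_{n-1}\in D$. -/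

import Mathlib

open scoped TensorProduct

namespace BiFree

/-! ### Left and right nodes, bi-non-crossing partitions -/

/-- The two sides: `left` is `ℓ`, `right` is `r`. -/
inductive Side
  | left
  | right
  deriving DecidableEq

/-- An order-preserving numbering for the order `≺_χ`: the left nodes come first, in increasing
order, and are followed by the right nodes, in decreasing order. -/
def chiPos {n : ℕ} (χ : Fin n → Side) (k : Fin n) : ℕ :=
  match χ k with
  | .left => k
  | .right => 2 * n - 1 - k

/-- The strict total order `≺_χ` on the nodes. -/
def ChiLT {n : ℕ} (χ : Fin n → Side) (j k : Fin n) : Prop := chiPos χ j < chiPos χ k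

/-- A partition is bi-non-crossing if no two distinct blocks cross with respect to `≺_χ`. -/
def IsBiNonCrossing {n : ℕ} (χ : Fin n → Side) {s : Finset (Fin n)} (π : Finpartition s) : Prop :=
  ∀ U ∈ π.parts, ∀ V ∈ π.parts, ∀ u₁ ∈ U, ∀ u₂ ∈ U, ∀ v₁ ∈ V, ∀ v₂ ∈ V,
    ChiLT χ u₁ v₁ → ChiLT χ v₁ u₂ → ChiLT χ u₂ v₂ → U = V

/-- The set `BNC(χ)`, ordered by refinement. -/
abbrev BNC {n : ℕ} (χ : Fin n → Side) : Type :=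
  {π : Finpartition (Finset.univ : Finset (Fin n)) // IsBiNonCrossing χ π}

/-- The one-block partition `1_χ`. -/
def BNC.one {n : ℕ} (χ : Fin n → Side) : BNC χ :=
  ⟨⊤, fun _ hU _ hV _ _ _ _ _ _ _ _ _ _ _ =>
    Finpartition.parts_top_subsingleton _ hU hV⟩

noncomputable instance {n : ℕ} (χ : Fin n → Side) : Fintype (BNC χ) :=
  Fintype.ofFinite _

open Classical in
noncomputable instance {n : ℕ} (χ : Fin n → Side) : LocallyFiniteOrder (BNC χ) :=
  Fintype.toLocallyFiniteOrder

open Classical in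
/-- The bi-non-crossing Möbius function: the Möbius function of the finite poset `BNC(χ)`. -/
noncomputable def muBNC {n : ℕ} (χ : Fin n → Side) (σ π : BNC χ) : ℂ :=
  IncidenceAlgebra.mu ℂ σ π

/-! ### `B`-`B`-non-commutative probability spaces -/

/-- A `B`-`B`-non-commutative probability space `(A, E, ε)`. -/
structure BBSpace (B A : Type*) [Ring B] [Algebra ℂ B] [Ring A] [Algebra ℂ A] where
  /-- The unital homomorphism `ε : B ⊗ B^op → A`. -/
  ε : B ⊗[ℂ] Bᵐᵒᵖ →ₐ[ℂ] A
  /-- The expectation. -/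
  E : A →ₗ[ℂ] B
  injective_left : Function.Injective fun b : B => ε (b ⊗ₜ[ℂ] 1)
  injective_right : Function.Injective fun b : Bᵐᵒᵖ => ε (1 ⊗ₜ[ℂ] b)
  E_mul (b₁ b₂ : B) (Z : A) : E (ε (b₁ ⊗ₜ[ℂ] MulOpposite.op b₂) * Z) = b₁ * E Z * b₂
  E_comm (b : B) (Z : A) :
    E (Z * ε (b ⊗ₜ[ℂ] 1)) = E (Z * ε (1 ⊗ₜ[ℂ] MulOpposite.op b))

section

variable {B A : Type*} [Ring B] [Algebra ℂ B] [Ring A] [Algebra ℂ A]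

namespace BBSpace

/-- `L_b = ε(b ⊗ 1)`. -/
def L (P : BBSpace B A) (b : B) : A := P.ε (b ⊗ₜ[ℂ] 1)

/-- `R_b = ε(1 ⊗ b)`. -/
def R (P : BBSpace B A) (b : B) : A := P.ε (1 ⊗ₜ[ℂ] MulOpposite.op b)

/-- The left algebra: the elements that commute with every `R_b`. -/
def leftAlgebra (P : BBSpace B A) : Subalgebra ℂ A :=
  Subalgebra.centralizer ℂ (Set.range P.R)

/-- The right algebra: the elements that commute with every `L_b`. -/
def rightAlgebra (P : BBSpace B A) : Subalgebra ℂ A :=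
  Subalgebra.centralizer ℂ (Set.range P.L)

/-- `L_b` on the left side and `R_b` on the right side. -/
def C (P : BBSpace B A) : Side → B → A
  | .left => P.L
  | .right => P.R

end BBSpace

/-! ### Moment and cumulant functions -/

/-- The product `Z_{v₁} ⋯ Z_{v_m}` over the nodes `v₁ < ⋯ < v_m` of `V`, in their usual order. -/
def orderedProd {n : ℕ} (Z : Fin n → A) (V : Finset (Fin n)) : A :=
  ((V.sort (· ≤ ·)).map Z).prod

/-- `V` is the block of `π` whose `≺_χ`-last node precedes the `≺_χ`-last node of each other
block. If `π` is bi-non-crossing, `V` is an interval of the underlying set of `π` for `≺_χ`. -/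
def ClosesFirst {n : ℕ} (χ : Fin n → Side) {s : Finset (Fin n)} (π : Finpartition s)
    (V : Finset (Fin n)) : Prop :=
  V ∈ π.parts ∧ ∀ U ∈ π.parts, U ≠ V → ∃ u ∈ U, ∀ v ∈ V, ChiLT χ v u

/-- `p` is the `≺_χ`-last of the elements of `W` that precede all of `V`. -/
def IsPred {n : ℕ} (χ : Fin n → Side) (V W : Finset (Fin n)) (p : Fin n) : Prop :=
  (p ∈ W ∧ ∀ v ∈ V, ChiLT χ p v) ∧
    ∀ k ∈ W, (∀ v ∈ V, ChiLT χ k v) → k = p ∨ ChiLT χ k p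

open Classical in
/-- The tuple `Z` in which `Z_p` is replaced by `Z_p L_b` (if `p` is a left node) or by `R_b Z_p`
(if `p` is a right node), where `p` is the `≺_χ`-predecessor of `V` in `W`. -/
noncomputable def insertAtPred (P : BBSpace B A) {n : ℕ} (χ : Fin n → Side)
    (V W : Finset (Fin n)) (b : B) (Z : Fin n → A) (k : Fin n) : A :=
  if IsPred χ V W k then
    match χ k with
    | .left => Z k * P.L b
    | .right => P.R b * Z k
  else Z k

open Classical in
/-- The operator-valued bi-free moment function `E_π`, for a partition `π` of a set `s` of nodes.

It is the bi-multiplicative function with `E_{1_χ}(Z_1, …, Z_n) = E(Z_1 ⋯ Z_n)`, and each step of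
the recursion is one of the reductions by which bi-multiplicativity determines `E_π`. With `V` the
interval block that closes first, `W` the union of the other blocks and `b = E_V(Z|_V)`:

* if no node precedes `V`, then `V` and `W` are consecutive intervals, and
  `E_π(Z) = b * E_{π|_W}(Z|_W)`;
* otherwise the first and the last node lie in `W`, and `b` is moved into the entry of the
  predecessor `p` of `V`, as `Z_p L_b` or `R_b Z_p`. -/
noncomputable def momentOn (P : BBSpace B A) {n : ℕ} (χ : Fin n → Side)
    (s : Finset (Fin n)) (π : Finpartition s) (Z : Fin n → A) : B :=
  if h : ∃ V, ClosesFirst χ π V ∧ V ≠ s then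
    if ∃ p ∈ s \ h.choose, ∀ v ∈ h.choose, ChiLT χ p v then
      momentOn P χ (s \ h.choose) (π.avoid h.choose)
        (insertAtPred P χ h.choose (s \ h.choose) (P.E (orderedProd Z h.choose)) Z)
    else
      P.E (orderedProd Z h.choose) * momentOn P χ (s \ h.choose) (π.avoid h.choose) Z
  else
    P.E (orderedProd Z s)
termination_by s.card
decreasing_by
  all_goals
    refine Finset.card_lt_card (Finset.sdiff_ssubset (π.le h.choose_spec.1.1) ?_)
    exact π.nonempty_of_mem_parts h.choose_spec.1.1

/-- The moment function `E_π(Z_1, …, Z_n)` for `π ∈ BNC(χ)`. -/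
noncomputable def moment (P : BBSpace B A) {n : ℕ} (χ : Fin n → Side) (π : BNC χ)
    (Z : Fin n → A) : B :=
  momentOn P χ Finset.univ π.1 Z

open Classical in
/-- The operator-valued bi-free cumulant function `κ_π(Z_1, …, Z_n)`. -/
noncomputable def cumulant (P : BBSpace B A) {n : ℕ} (χ : Fin n → Side) (π : BNC χ)
    (Z : Fin n → A) : B :=
  ∑ σ : BNC χ with σ ≤ π, muBNC χ σ π • moment P χ σ Z

/-! ### The cumulants of a two-faced family -/

/-- The side of an index in `I ⊔ J`. -/
def sideOf {I J : Type*} : I ⊕ J → Side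
  | .inl _ => .left
  | .inr _ => .right

/-- `χ_ω`. -/
def chiOf {I J : Type*} {n : ℕ} (ω : Fin n → I ⊕ J) (k : Fin n) : Side := sideOf (ω k)

open Classical in
/-- The `k`-th argument of `κ_{Z,ω}(b_1, …, b_{n-1})`, where `n = m + 1` and nodes and the `b`'s are
numbered from `0`. There is no factor `C_b` in front of `Z_{ω(k)}` if `k` is the first node on its
side. In front of the other nodes the `b`'s are used up in order; so the node `k` receives number
`k - 1` as long as all nodes before it lie on the side of node `0`, and number `k - 2` afterwards.
If both sides occur, the last `b` is put to the right of the last argument. -/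
noncomputable def kappaArg (P : BBSpace B A) {I J : Type*} (Z : I ⊕ J → A) {m : ℕ}
    (ω : Fin (m + 1) → I ⊕ J) (b : Fin m → B) (k : Fin (m + 1)) : A :=
  (if h : ∃ j < k, chiOf ω j = chiOf ω k then
      P.C (chiOf ω k) (b ⟨if ∃ j < k, chiOf ω j ≠ chiOf ω 0 then k - 2 else k - 1, by
        obtain ⟨j, hj, -⟩ := h
        have hj' : j.val < k.val := hj
        have hk := k.isLt
        split_ifs <;> omega⟩)
    else 1) *
  Z (ω k) *
  (if h : k = Fin.last m ∧ ∃ j, chiOf ω j ≠ chiOf ω 0 then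
      P.C (chiOf ω k) (b ⟨m - 1, by
        obtain ⟨-, j, hj⟩ := h
        have h0 : j ≠ 0 := fun h => hj (by rw [h])
        have h1 := Fin.val_ne_of_ne h0
        have h2 := j.isLt
        simp only [Fin.val_zero] at h1
        omega⟩)
    else 1)

/-- `κ_{Z,ω}(b_1, …, b_{n-1})` with `n = m + 1`. -/
noncomputable def kappa (P : BBSpace B A) {I J : Type*} (Z : I ⊕ J → A) {m : ℕ}
    (ω : Fin (m + 1) → I ⊕ J) (b : Fin m → B) : B :=
  cumulant P (chiOf ω) (BNC.one (chiOf ω)) (kappaArg P Z ω b)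

/-! ### Passing to a subalgebra -/

/-- A conditional expectation of `B` onto the unital subalgebra `D`. -/
structure CondExp (D : Subalgebra ℂ B) where
  /-- The underlying linear map. -/
  F : B →ₗ[ℂ] D
  F_coe (d : D) : F d = d
  F_mul (d₁ d₂ : D) (b : B) : F (d₁ * b * d₂) = d₁ * F b * d₂

/-- The `D`-`D`-non-commutative probability space `(A, F ∘ E, ε|_{D ⊗ D^op})`. -/
noncomputable def BBSpace.restrict (P : BBSpace B A) {D : Subalgebra ℂ B} (F : CondExp D) :
    BBSpace D A where
  ε := P.ε.comp (Algebra.TensorProduct.map D.val (AlgHom.op D.val))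
  E := F.F ∘ₗ P.E
  injective_left d₁ d₂ h := by
    apply Subtype.ext
    apply P.injective_left
    simpa using h
  injective_right d₁ d₂ h := by
    have h' := P.injective_right (a₁ := MulOpposite.op (d₁.unop : B))
      (a₂ := MulOpposite.op (d₂.unop : B)) (by simpa using h)
    exact MulOpposite.unop_injective (Subtype.ext (MulOpposite.op_injective h'))
  E_mul d₁ d₂ Z := by
    have h := P.E_mul d₁ d₂ Z
    simp only [AlgHom.comp_apply, Algebra.TensorProduct.map_tmul, LinearMap.comp_apply]
    rw [← F.F_mul, ← h]
    rfl
  E_comm d Z := by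
    have h := P.E_comm d Z
    simp only [AlgHom.comp_apply, Algebra.TensorProduct.map_tmul, LinearMap.comp_apply, map_one]
    exact congrArg F.F h

end

end BiFree

/- Call `X` a decoration of `Z` if each `X k` is obtained from `Z (ω k)` by multiplying it on both
sides by operators `C_d` of its own side, `d ∈ D`. Both the tuples on which `κ_{Z,ω}` is evaluated
and those produced by the recursion for `E_π` are of this kind. Since operators of one side commute
with everything on the other side, in a product `X₁ ⋯ Xₙ` the operators can be pushed past the
entries of the other side until they either reach an end of the product or stand in front of an
entry that is not the first on its side. Under `E` the outer operators become factors from `D`,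
except for a single one on the right, and what remains is the moment of the arguments of some
`κ_{Z,ω}(d₁, …, dₙ₋₁)`. That moment is the cumulant, which lies in `D` by hypothesis, minus
multiples of moments along finer partitions, which are built from shorter products
`X_{v₁} ⋯ X_{vₘ}`. By induction all moments of decorations lie in `D`. On `D` the map `F` is the
identity, so the recursions for `E^B_π` and `E^D_π` agree. -/

namespace BiFree

/-- The other side. It allows the arguments that are symmetric in `ℓ` and `r` to be given once. -/
def Side.opposite : Side → Side
  | .left => .right
  | .right => .left

theorem Side.eq_opposite_of_ne {s t : Side} (h : s ≠ t) : s = t.opposite := by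
  cases s <;> cases t <;> first | rfl | exact absurd rfl h

/-! ### Decorated products in a monoid -/

section Monoid

open scoped Pointwise

variable {M : Type*} [Monoid M] (S : Side → Submonoid M) {n : ℕ}

/-- The tuples that arise from `z` by multiplying each entry `z k` on the left and on the right by
elements of the submonoid `S (χ k)` that belongs to its side. -/
def decorations (χ : Fin n → Side) (z : Fin n → M) : Set (Fin n → M) :=
  {X | ∀ k, X k ∈ DoubleCoset.doubleCoset (z k) (S (χ k)) (S (χ k))}

/-- The coefficients that a normal form may have in front of its entries: the first entry on each
side gets the coefficient `1`. -/
def frontCoeffs (χ : Fin n → Side) : Set (Fin n → M) :=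
  {c | ∀ k, c k ∈ S (χ k) ∧ ((∀ j < k, χ j ≠ χ k) → c k = 1)}

/-- The products `u * (c₁ z₁ ⋯ cₙ zₙ) * v` with coefficients `c ∈ frontCoeffs S χ` and with `u` and
`v` in `S ℓ * S r`. -/
def normalForms (χ : Fin n → Side) (z : Fin n → M) : Set M :=
  ⋃ c ∈ frontCoeffs S χ, DoubleCoset.doubleCoset (List.ofFn (c * z)).prod
    (S .left * S .right : Set M) (S .left * S .right : Set M)

variable {S} {χ : Fin n → Side} {z : Fin n → M}

theorem comp_mem_decorations {m : ℕ} {X : Fin n → M} (hX : X ∈ decorations S χ z)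
    (f : Fin m → Fin n) : X ∘ f ∈ decorations S (χ ∘ f) (z ∘ f) :=
  fun k => hX (f k)

theorem prod_ofFn_castSucc_mul_last (X : Fin (n + 1) → M) :
    (List.ofFn X).prod = (List.ofFn (X ∘ Fin.castSucc)).prod * X (Fin.last n) := by
  rw [List.ofFn_succ', List.concat_eq_append, List.prod_append, List.prod_singleton]
  rfl

theorem snoc_mem_frontCoeffs {χ : Fin (n + 1) → Side} {c : Fin n → M} {x : M}
    (hc : c ∈ frontCoeffs S (χ ∘ Fin.castSucc)) (hx : x ∈ S (χ (Fin.last n)))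
    (hx_first : (∀ j : Fin n, χ j.castSucc ≠ χ (Fin.last n)) → x = 1) :
    (Fin.snoc c x : Fin (n + 1) → M) ∈ frontCoeffs S χ := by
  intro k
  induction k using Fin.lastCases with
  | last =>
    rw [Fin.snoc_last]
    exact ⟨hx, fun h => hx_first fun j => h _ j.castSucc_lt_last⟩
  | cast k =>
    rw [Fin.snoc_castSucc]
    exact ⟨(hc k).1, fun h => (hc k).2 fun j hj => h _ (Fin.castSucc_lt_castSucc_iff.2 hj)⟩

theorem prod_ofFn_snoc_mul (c : Fin n → M) (x : M) (z : Fin (n + 1) → M) :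
    (List.ofFn ((Fin.snoc c x : Fin (n + 1) → M) * z)).prod =
      (List.ofFn (c * (z ∘ Fin.castSucc))).prod * (x * z (Fin.last n)) := by
  rw [prod_ofFn_castSucc_mul_last, Pi.mul_apply, Fin.snoc_last]
  congr 3
  funext k
  simp only [Function.comp_apply, Pi.mul_apply, Fin.snoc_castSucc]

theorem coe_mul_coe_opposite (hS : ∀ s, ∀ x ∈ S s, ∀ y ∈ S s.opposite, Commute x y) (s : Side) :
    (S s * S s.opposite : Set M) = S .left * S .right := by
  cases s
  · rfl
  · ext x
    simp only [Side.opposite, Set.mem_mul, SetLike.mem_coe]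
    constructor
    · rintro ⟨y, hy, x, hx, rfl⟩
      exact ⟨x, hx, y, hy, hS .left x hx y hy⟩
    · rintro ⟨x, hx, y, hy, rfl⟩
      exact ⟨y, hy, x, hx, hS .right y hy x hx⟩

theorem commute_prod_of_forall_ne (hS : ∀ s, ∀ x ∈ S s, ∀ y ∈ S s.opposite, Commute x y)
    (hz : ∀ k, ∀ x ∈ S (χ k).opposite, Commute x (z k)) {c : Fin n → M}
    (hc : ∀ k, c k ∈ S (χ k)) {s : Side} (hs : ∀ k, χ k ≠ s) {x : M} (hx : x ∈ S s) :
    Commute x (List.ofFn (c * z)).prod := by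
  refine Commute.list_prod_right _ _ fun y hy => ?_
  obtain ⟨k, rfl⟩ := List.mem_ofFn.1 hy
  rw [Side.eq_opposite_of_ne (hs k).symm] at hx
  exact (hS _ _ (hc k) x hx).symm.mul_right (hz k x hx)

theorem mul_mem_normalForms (hS : ∀ s, ∀ x ∈ S s, ∀ y ∈ S s.opposite, Commute x y)
    {χ : Fin (n + 1) → Side} {z : Fin (n + 1) → M}
    (hz : ∀ k, ∀ x ∈ S (χ k).opposite, Commute x (z k)) {x y : M}
    (hx : x ∈ normalForms S (χ ∘ Fin.castSucc) (z ∘ Fin.castSucc))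
    (hy : y ∈ DoubleCoset.doubleCoset (z (Fin.last n)) (S (χ (Fin.last n))) (S (χ (Fin.last n)))) :
    x * y ∈ normalForms S χ z := by
  set s := χ (Fin.last n)
  simp only [normalForms, ← coe_mul_coe_opposite hS s, Set.mem_iUnion,
    DoubleCoset.mem_doubleCoset, exists_prop] at hx ⊢
  obtain ⟨c, hc, _, ⟨u, hu, u', hu', rfl⟩, _, ⟨v, hv, v', hv', rfl⟩, rfl⟩ := hx
  obtain ⟨p, hp, q, hq, rfl⟩ := DoubleCoset.mem_doubleCoset.1 hy
  set W := (List.ofFn (c * (z ∘ Fin.castSucc))).prod with hW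
  set t := z (Fin.last n) with ht
  have hvp : v * p ∈ S s := mul_mem hv hp
  have hv'_right : v' * (p * t * q) = p * t * q * v' :=
    (((hS s p hp v' hv').symm.mul_right (hz _ v' hv')).mul_right (hS s q hq v' hv').symm).eq
  by_cases hfirst : ∀ j : Fin n, χ j.castSucc ≠ s
  · have hvp_left : Commute (v * p) (u' * W) := (hS s _ hvp u' hu').mul_right
      (commute_prod_of_forall_ne hS (fun k => hz k.castSucc) (fun k => (hc k).1) hfirst hvp)
    refine ⟨_, snoc_mem_frontCoeffs hc (one_mem _) fun _ => rfl,
      _, ⟨u * (v * p), mul_mem hu hvp, u', hu', rfl⟩, _, ⟨q, hq, v', hv', rfl⟩, ?_⟩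
    rw [prod_ofFn_snoc_mul, ← hW, ← ht]
    calc u * u' * W * (v * v') * (p * t * q)
        = u * (u' * W * (v * p)) * t * q * v' := by
          rw [← mul_assoc _ v, mul_assoc _ v', hv'_right]; simp only [mul_assoc]
      _ = u * (v * p) * u' * (W * (1 * t)) * (q * v') := by
          rw [← hvp_left.eq]; simp only [mul_assoc, one_mul]
  · refine ⟨_, snoc_mem_frontCoeffs hc hvp fun h => absurd h hfirst,
      _, ⟨u, hu, u', hu', rfl⟩, _, ⟨q, hq, v', hv', rfl⟩, ?_⟩
    rw [prod_ofFn_snoc_mul, ← hW, ← ht, ← mul_assoc _ v, mul_assoc _ v', hv'_right]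
    simp only [mul_assoc]

theorem prod_mem_normalForms (hS : ∀ s, ∀ x ∈ S s, ∀ y ∈ S s.opposite, Commute x y)
    (hz : ∀ k, ∀ x ∈ S (χ k).opposite, Commute x (z k)) {X : Fin n → M}
    (hX : X ∈ decorations S χ z) : (List.ofFn X).prod ∈ normalForms S χ z := by
  induction n with
  | zero =>
    have hone : (1 : M) ∈ (S .left * S .right : Set M) :=
      ⟨1, one_mem _, 1, one_mem _, one_mul 1⟩
    simp only [normalForms, Set.mem_iUnion, DoubleCoset.mem_doubleCoset]
    exact ⟨1, fun k => k.elim0, 1, hone, 1, hone, by simp⟩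
  | succ n ih =>
    rw [prod_ofFn_castSucc_mul_last]
    exact mul_mem_normalForms hS hz
      (ih (fun k => hz k.castSucc) (comp_mem_decorations hX Fin.castSucc)) (hX (Fin.last n))

end Monoid

/-! ### Operators with coefficients in a subalgebra -/

namespace BBSpace

variable {B A : Type*} [Ring B] [Algebra ℂ B] [Ring A] [Algebra ℂ A] (P : BBSpace B A)
  {D : Subalgebra ℂ B}

theorem C_one (s : Side) : P.C s 1 = 1 := by
  cases s <;> simp [C, L, R, ← Algebra.TensorProduct.one_def]

theorem L_mul_L (a b : B) : P.L a * P.L b = P.L (a * b) := by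
  simp [L, ← map_mul]

theorem R_mul_R (a b : B) : P.R a * P.R b = P.R (b * a) := by
  simp [R, ← map_mul]

theorem commute_L_R (a b : B) : Commute (P.L a) (P.R b) := by
  simp [Commute, SemiconjBy, L, R, ← map_mul]

theorem E_L_mul (b : B) (X : A) : P.E (P.L b * X) = b * P.E X := by
  simpa [L] using P.E_mul b 1 X

theorem E_R_mul (b : B) (X : A) : P.E (P.R b * X) = P.E X * b := by
  simpa [R] using P.E_mul 1 b X

theorem E_mul_C (s : Side) (b : B) (X : A) : P.E (X * P.C s b) = P.E (X * P.L b) := by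
  cases s
  · rfl
  · exact (P.E_comm b X).symm

theorem E_mul_L_mul_R (s : Side) (a b : B) (X : A) :
    P.E (X * (P.L a * P.R b)) = P.E (X * P.C s (a * b)) := by
  calc P.E (X * (P.L a * P.R b))
      = P.E (X * P.L a * P.L b) := by rw [← mul_assoc, ← P.E_mul_C .right, C]
    _ = P.E (X * P.C s (a * b)) := by rw [mul_assoc, L_mul_L, E_mul_C]

variable (D) in
/-- The submonoid of the operators `L_d` (for the left side) or `R_d` (for the right side) with
`d ∈ D`. -/
def scalars (s : Side) : Submonoid A where
  carrier := P.C s '' D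
  one_mem' := ⟨1, one_mem D, P.C_one s⟩
  mul_mem' := by
    rintro _ _ ⟨a, ha, rfl⟩ ⟨b, hb, rfl⟩
    cases s
    · exact ⟨a * b, mul_mem ha hb, (P.L_mul_L a b).symm⟩
    · exact ⟨b * a, mul_mem hb ha, (P.R_mul_R a b).symm⟩

theorem C_mem_scalars (s : Side) {d : B} (hd : d ∈ D) : P.C s d ∈ P.scalars D s :=
  ⟨d, hd, rfl⟩

variable {P}

theorem commute_scalars_opposite (s : Side) (x : A) (hx : x ∈ P.scalars D s) (y : A)
    (hy : y ∈ P.scalars D s.opposite) : Commute x y := by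
  obtain ⟨a, -, rfl⟩ := hx
  obtain ⟨b, -, rfl⟩ := hy
  cases s
  · exact P.commute_L_R a b
  · exact (P.commute_L_R b a).symm

theorem E_scalar_mul_mem {s : Side} {x X : A} (hx : x ∈ P.scalars D s) (hX : P.E X ∈ D) :
    P.E (x * X) ∈ D := by
  obtain ⟨d, hd, rfl⟩ := hx
  cases s
  · exact P.E_L_mul d X ▸ mul_mem hd hX
  · exact P.E_R_mul d X ▸ mul_mem hX hd

variable (F : CondExp D)

theorem restrict_L (d : D) : (P.restrict F).L d = P.L d := by
  simp [L, restrict]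

theorem restrict_R (d : D) : (P.restrict F).R d = P.R d := by
  simp [R, restrict]

theorem restrict_C (s : Side) (d : D) : (P.restrict F).C s d = P.C s d := by
  cases s
  · exact restrict_L F d
  · exact restrict_R F d

theorem coe_restrict_E {X : A} (hX : P.E X ∈ D) : ((P.restrict F).E X : B) = P.E X :=
  congrArg Subtype.val (F.F_coe ⟨P.E X, hX⟩)

theorem leftAlgebra_le_restrict : P.leftAlgebra ≤ (P.restrict F).leftAlgebra :=
  Subalgebra.centralizer_le _ _ _ (Set.range_subset_iff.2 fun d => ⟨d, (restrict_R F d).symm⟩)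

theorem rightAlgebra_le_restrict : P.rightAlgebra ≤ (P.restrict F).rightAlgebra :=
  Subalgebra.centralizer_le _ _ _ (Set.range_subset_iff.2 fun d => ⟨d, (restrict_L F d).symm⟩)

theorem commute_of_mem_leftAlgebra_restrict {Z : A} (hZ : Z ∈ (P.restrict F).leftAlgebra) :
    ∀ x ∈ P.scalars D .right, Commute x Z := by
  rintro _ ⟨d, hd, rfl⟩
  exact Subalgebra.mem_centralizer_iff ℂ |>.1 hZ _ ⟨⟨d, hd⟩, restrict_R F ⟨d, hd⟩⟩

theorem commute_of_mem_rightAlgebra_restrict {Z : A} (hZ : Z ∈ (P.restrict F).rightAlgebra) :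
    ∀ x ∈ P.scalars D .left, Commute x Z := by
  rintro _ ⟨d, hd, rfl⟩
  exact Subalgebra.mem_centralizer_iff ℂ |>.1 hZ _ ⟨⟨d, hd⟩, restrict_L F ⟨d, hd⟩⟩

end BBSpace

/-! ### Moments along a partition -/

section Moments

variable {n : ℕ} (χ : Fin n → Side) {s V : Finset (Fin n)} {π : Finpartition s}

theorem chiPos_injective : Function.Injective (chiPos χ) := by
  intro j k h
  unfold chiPos at h
  split at h <;> split at h <;> omega

variable {χ}

theorem exists_closesFirst_ne (hs : s.Nonempty) (hπ : π ≠ ⊤) :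
    ∃ V, ClosesFirst χ π V ∧ V ≠ s := by
  obtain ⟨V, hV, hmin⟩ := π.parts.exists_min_image (fun U => U.sup (chiPos χ))
    (π.parts_nonempty hs.ne_empty)
  refine ⟨V, ⟨hV, fun U hU hUV => ?_⟩, ?_⟩
  · obtain ⟨u, hu, hu_last⟩ := U.exists_mem_eq_sup (π.nonempty_of_mem_parts hU) (chiPos χ)
    refine ⟨u, hu, fun v hv => lt_of_le_of_ne ?_ fun h => ?_⟩
    · exact (Finset.le_sup hv).trans ((hmin U hU).trans hu_last.le)
    · exact hUV (π.eq_of_mem_parts hU hV hu (chiPos_injective χ h ▸ hv))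
  · rintro rfl
    exact hπ (top_le_iff.1 fun U hU => ⟨V, hV, (⊤ : Finpartition V).le hU⟩)

namespace ClosesFirst

theorem nonempty (hV : ClosesFirst χ π V) : V.Nonempty := π.nonempty_of_mem_parts hV.1

theorem subset (hV : ClosesFirst χ π V) : V ⊆ s := π.le hV.1

theorem unique {U : Finset (Fin n)} (hU : ClosesFirst χ π U) (hV : ClosesFirst χ π V) :
    U = V := by
  by_contra hne
  obtain ⟨u, hu, hVu⟩ := hV.2 U hU.1 hne
  obtain ⟨v, hv, hUv⟩ := hU.2 V hV.1 (Ne.symm hne)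
  exact lt_asymm (hVu v hv) (hUv u hu)

end ClosesFirst

variable {B A : Type*} [Ring A]

theorem orderedProd_univ (X : Fin n → A) :
    orderedProd X Finset.univ = (List.ofFn X).prod := by
  rw [orderedProd, Fin.sort_univ, List.ofFn_eq_map]

theorem orderedProd_eq_prod_ofFn (X : Fin n → A) {m : ℕ} (hV : V.card = m) :
    orderedProd X V = (List.ofFn (X ∘ V.orderEmbOfFin hV)).prod := by
  rw [orderedProd, ← V.listMap_orderEmbOfFin_finRange hV, List.ofFn_eq_map, List.map_map]

variable [Ring B] [Algebra ℂ B] [Algebra ℂ A] {P : BBSpace B A}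

theorem momentOn_top (X : Fin n → A) : momentOn P χ s ⊤ X = P.E (orderedProd X s) := by
  rw [momentOn, dif_neg]
  rintro ⟨V, hV, hne⟩
  exact hne (Finset.mem_singleton.1 (Finpartition.parts_top_subset s hV.1))

open Classical in
theorem momentOn_of_closesFirst (hV : ClosesFirst χ π V) (hne : V ≠ s) (X : Fin n → A) :
    momentOn P χ s π X =
      if ∃ p ∈ s \ V, ∀ v ∈ V, ChiLT χ p v then
        momentOn P χ (s \ V) (π.avoid V)
          (insertAtPred P χ V (s \ V) (P.E (orderedProd X V)) X)
      else
        P.E (orderedProd X V) * momentOn P χ (s \ V) (π.avoid V) X := by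
  have h : ∃ V, ClosesFirst χ π V ∧ V ≠ s := ⟨V, hV, hne⟩
  have hV' : h.choose = V := h.choose_spec.1.unique hV
  rw [momentOn, dif_pos h, hV']

variable {D : Subalgebra ℂ B} {T : Set (Fin n → A)}

/-- The recursion meets the product over the whole of `s` only if `π = ⊤`, hence the shape of
`hE`. -/
theorem momentOn_mem
    (hT : ∀ X ∈ T, ∀ V W : Finset (Fin n), ∀ b ∈ D, insertAtPred P χ V W b X ∈ T)
    (hs : s.Nonempty)
    (hE : ∀ V ⊆ s, V.Nonempty → (V = s → π = ⊤) → ∀ X ∈ T, P.E (orderedProd X V) ∈ D)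
    {X : Fin n → A} (hX : X ∈ T) : momentOn P χ s π X ∈ D := by
  induction s using Finset.strongInduction generalizing X with
  | H s ih =>
  by_cases hπ : π = ⊤
  · rw [hπ, momentOn_top]
    exact hE s subset_rfl hs (fun _ => hπ) X hX
  obtain ⟨V, hV, hVs⟩ := exists_closesFirst_ne (χ := χ) hs hπ
  have hrest : s \ V ⊂ s := Finset.sdiff_ssubset hV.subset hV.nonempty
  have hrest_nonempty : (s \ V).Nonempty :=
    Finset.sdiff_nonempty.2 fun h => hVs (hV.subset.antisymm h)
  have hb : P.E (orderedProd X V) ∈ D := hE V hV.subset hV.nonempty (fun h => absurd h hVs) X hX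
  have ih_rest {X' : Fin n → A} (hX' : X' ∈ T) : momentOn P χ (s \ V) (π.avoid V) X' ∈ D :=
    ih _ hrest hrest_nonempty (fun U hU hne _ => hE U (hU.trans hrest.subset) hne
      fun h => absurd (h ▸ hU) hrest.not_subset) hX'
  rw [momentOn_of_closesFirst hV hVs]
  split_ifs
  · exact ih_rest (hT X hX _ _ _ hb)
  · exact mul_mem hb (ih_rest hX)

theorem insertAtPred_restrict (F : CondExp D) (V W : Finset (Fin n)) (d : D) (X : Fin n → A) :
    insertAtPred (P.restrict F) χ V W d X = insertAtPred P χ V W (d : B) X := by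
  funext k
  simp only [insertAtPred, BBSpace.restrict_L, BBSpace.restrict_R]

theorem coe_momentOn_restrict (F : CondExp D)
    (hT : ∀ X ∈ T, ∀ V W : Finset (Fin n), ∀ b ∈ D, insertAtPred P χ V W b X ∈ T)
    (hs : s.Nonempty)
    (hE : ∀ V ⊆ s, V.Nonempty → ∀ X ∈ T, P.E (orderedProd X V) ∈ D)
    {X : Fin n → A} (hX : X ∈ T) :
    ((momentOn (P.restrict F) χ s π X : D) : B) = momentOn P χ s π X := by
  induction s using Finset.strongInduction generalizing X with
  | H s ih =>
  by_cases hπ : π = ⊤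
  · rw [hπ, momentOn_top, momentOn_top]
    exact BBSpace.coe_restrict_E F (hE s subset_rfl hs X hX)
  obtain ⟨V, hV, hVs⟩ := exists_closesFirst_ne (χ := χ) hs hπ
  have hrest : s \ V ⊂ s := Finset.sdiff_ssubset hV.subset hV.nonempty
  have hrest_nonempty : (s \ V).Nonempty :=
    Finset.sdiff_nonempty.2 fun h => hVs (hV.subset.antisymm h)
  have hb : P.E (orderedProd X V) ∈ D := hE V hV.subset hV.nonempty X hX
  have ih_rest {X' : Fin n → A} (hX' : X' ∈ T) :
      ((momentOn (P.restrict F) χ (s \ V) (π.avoid V) X' : D) : B) =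
        momentOn P χ (s \ V) (π.avoid V) X' :=
    ih _ hrest hrest_nonempty (fun U hU => hE U (hU.trans hrest.subset)) hX'
  rw [momentOn_of_closesFirst hV hVs, momentOn_of_closesFirst hV hVs]
  split_ifs
  · rw [insertAtPred_restrict, BBSpace.coe_restrict_E F hb, ih_rest (hT X hX _ _ _ hb)]
  · rw [MulMemClass.coe_mul, BBSpace.coe_restrict_E F hb, ih_rest hX]

theorem insertAtPred_mem_decorations {Z X : Fin n → A}
    (hX : X ∈ decorations (P.scalars D) χ Z) (V W : Finset (Fin n)) {b : B} (hb : b ∈ D) :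
    insertAtPred P χ V W b X ∈ decorations (P.scalars D) χ Z := by
  intro k
  obtain ⟨p, hp, q, hq, hXk⟩ := DoubleCoset.mem_doubleCoset.1 (hX k)
  have hCb := P.C_mem_scalars (χ k) hb
  rw [DoubleCoset.mem_doubleCoset, insertAtPred, hXk]
  split_ifs
  · cases hk : χ k <;> rw [hk] at hp hq hCb
    · exact ⟨p, hp, q * P.L b, mul_mem hq hCb, mul_assoc _ _ _⟩
    · exact ⟨P.R b * p, mul_mem hCb hp, q, hq, by simp only [mul_assoc]⟩
  · exact ⟨p, hp, q, hq, rfl⟩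

theorem cumulant_one_eq (X : Fin n → A) :
    cumulant P χ (BNC.one χ) X = P.E (List.ofFn X).prod +
      ∑ σ ∈ Finset.univ.erase (BNC.one χ), muBNC χ σ (BNC.one χ) • moment P χ σ X := by
  classical
  have hle (σ : BNC χ) : σ ≤ BNC.one χ := (le_top : σ.1 ≤ ⊤)
  rw [cumulant, Finset.filter_true_of_mem fun σ _ => hle σ,
    ← Finset.add_sum_erase _ _ (Finset.mem_univ (BNC.one χ)), muBNC, IncidenceAlgebra.mu_self,
    one_smul, moment, BNC.one, momentOn_top, orderedProd_univ]

theorem coe_cumulant_restrict [NeZero n] (F : CondExp D)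
    (hT : ∀ X ∈ T, ∀ V W : Finset (Fin n), ∀ b ∈ D, insertAtPred P χ V W b X ∈ T)
    (hE : ∀ V : Finset (Fin n), V.Nonempty → ∀ X ∈ T, P.E (orderedProd X V) ∈ D)
    (π : BNC χ) {X : Fin n → A} (hX : X ∈ T) :
    ((cumulant (P.restrict F) χ π X : D) : B) = cumulant P χ π X := by
  rw [cumulant, cumulant, AddSubmonoidClass.coe_finsetSum]
  refine Finset.sum_congr rfl fun σ _ => ?_
  rw [SetLike.val_smul, moment, moment,
    coe_momentOn_restrict F hT Finset.univ_nonempty (fun V _ => hE V) hX]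

end Moments

/-! ### The arguments of the cumulants of a two-faced family -/

section KappaCoeffs

variable {β : Type*} {m : ℕ} (χ : Fin (m + 1) → Side) (g : Fin (m + 2) → β)

/-- The tuple `b` for which the factor in front of node `k` in `κ_{Z,ω}(b)` is `C_{g k}` for every
node `k` that is not the first one on its side, and for which, if both sides occur, the factor at
the right end is `C_{g (m + 1)}`. As in `kappaArg`, the numbering of the `b`'s lags behind that of
the nodes by one before the second side occurs, and by two afterwards. -/
def kappaCoeffs (i : Fin m) : β :=
  if ∀ j ≤ i.succ, χ j = χ 0 then g i.succ.castSucc else g i.succ.succ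

variable {χ}

theorem kappaCoeffs_sub_one {k : Fin (m + 1)} (hk : ∃ j < k, χ j = χ k)
    (hside : ∀ j < k, χ j = χ 0) (hlt : k.val - 1 < m) :
    kappaCoeffs χ g ⟨k - 1, hlt⟩ = g k.castSucc := by
  obtain ⟨j, hjk, hj⟩ := hk
  have hsucc : Fin.succ ⟨k.val - 1, hlt⟩ = k := Fin.ext (by simp; lia)
  rw [kappaCoeffs, hsucc, if_pos]
  intro i hik
  rcases hik.lt_or_eq with hik | rfl
  · exact hside i hik
  · exact hj.symm.trans (hside j hjk)

theorem kappaCoeffs_sub_two {k : Fin (m + 1)} (hk : ∃ j < k, χ j ≠ χ 0) (hlt : k.val - 2 < m) :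
    kappaCoeffs χ g ⟨k - 2, hlt⟩ = g k.castSucc := by
  obtain ⟨j, hjk, hj⟩ := hk
  have hj0 : j ≠ 0 := fun h => hj (h ▸ rfl)
  have hsucc : Fin.succ (Fin.succ ⟨k.val - 2, hlt⟩) = k.castSucc := Fin.ext (by simp; lia)
  rw [kappaCoeffs, hsucc, if_neg]
  exact fun h => hj (h j (Fin.le_def.2 (by simp; lia)))

theorem kappaCoeffs_last (hχ : ∃ j, χ j ≠ χ 0) (hlt : m - 1 < m) :
    kappaCoeffs χ g ⟨m - 1, hlt⟩ = g (Fin.last (m + 1)) := by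
  obtain ⟨j, hj⟩ := hχ
  have hsucc : Fin.succ (⟨m - 1, hlt⟩ : Fin m) = Fin.last m := Fin.ext (by simp; lia)
  rw [kappaCoeffs, hsucc, if_neg fun h => hj (h j j.le_last), Fin.succ_last]

end KappaCoeffs

section Kappa

variable {B A I J : Type*} [Ring B] [Algebra ℂ B] [Ring A] [Algebra ℂ A] {P : BBSpace B A}
  {D : Subalgebra ℂ B} {Z : I ⊕ J → A} {m : ℕ} {ω : Fin (m + 1) → I ⊕ J}

theorem kappaArg_mem_decorations {b : Fin m → B} (hb : ∀ i, b i ∈ D) :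
    kappaArg P Z ω b ∈ decorations (P.scalars D) (chiOf ω) (Z ∘ ω) := by
  intro k
  refine DoubleCoset.mem_doubleCoset.2 ⟨_, ?_, _, ?_, rfl⟩
  · split
    · exact P.C_mem_scalars _ (hb _)
    · exact one_mem (P.scalars D (chiOf ω k))
  · split
    · exact P.C_mem_scalars _ (hb _)
    · exact one_mem (P.scalars D (chiOf ω k))

open Classical in
theorem kappaArg_kappaCoeffs (g : Fin (m + 2) → B) (k : Fin (m + 1)) :
    kappaArg P Z ω (kappaCoeffs (chiOf ω) g) k =
      (if ∃ j < k, chiOf ω j = chiOf ω k then P.C (chiOf ω k) (g k.castSucc) else 1) * Z (ω k) *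
        if k = Fin.last m ∧ ∃ j, chiOf ω j ≠ chiOf ω 0 then
          P.C (chiOf ω k) (g (Fin.last (m + 1)))
        else 1 := by
  unfold kappaArg
  congr 2
  · by_cases hk : ∃ j < k, chiOf ω j = chiOf ω k
    · rw [dif_pos hk, if_pos hk]
      congr 1
      by_cases hside : ∃ j < k, chiOf ω j ≠ chiOf ω 0
      · simp only [if_pos hside]
        exact kappaCoeffs_sub_two g hside _
      · simp only [if_neg hside]
        push Not at hside
        exact kappaCoeffs_sub_one g hk hside _
    · rw [dif_neg hk, if_neg hk]
  · funext h
    rw [kappaCoeffs_last g h.2]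

open Classical in
theorem exists_prod_kappaArg_eq {c : Fin (m + 1) → A}
    (hc : c ∈ frontCoeffs (P.scalars D) (chiOf ω)) {e : B} (he : e ∈ D) :
    ∃ d : Fin m → D, (List.ofFn (kappaArg P Z ω fun i => (d i : B))).prod =
      (List.ofFn (c * (Z ∘ ω))).prod *
        if ∃ j, chiOf ω j ≠ chiOf ω 0 then P.C (chiOf ω (Fin.last m)) e else 1 := by
  choose g hg hgc using fun k => (hc k).1
  have hG (i : Fin (m + 2)) : (Fin.snoc g e : Fin (m + 2) → B) i ∈ D := by
    induction i using Fin.lastCases with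
    | last => rwa [Fin.snoc_last]
    | cast k => rw [Fin.snoc_castSucc]; exact hg k
  have hd (i : Fin m) : kappaCoeffs (chiOf ω) (Fin.snoc g e : Fin (m + 2) → B) i ∈ D := by
    unfold kappaCoeffs
    split_ifs <;> exact hG _
  have hfront (k : Fin (m + 1)) :
      (if ∃ j < k, chiOf ω j = chiOf ω k then P.C (chiOf ω k) (g k) else 1) = c k := by
    split_ifs with h
    · exact hgc k
    · push Not at h
      exact ((hc k).2 h).symm
  refine ⟨fun i => ⟨_, hd i⟩, ?_⟩
  rw [prod_ofFn_castSucc_mul_last, prod_ofFn_castSucc_mul_last (c * _)]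
  simp only [Function.comp_def, kappaArg_kappaCoeffs, Fin.snoc_castSucc, Fin.snoc_last, hfront,
    Pi.mul_apply, (Fin.castSucc_lt_last _).ne, true_and, false_and, if_false, mul_one, mul_assoc]

theorem E_prod_mem_of_mem_decorations
    (hZ : ∀ i, ∀ x ∈ P.scalars D (sideOf i).opposite, Commute x (Z i))
    (hκ : ∀ d : Fin m → D, P.E (List.ofFn (kappaArg P Z ω fun i => (d i : B))).prod ∈ D)
    {X : Fin (m + 1) → A} (hX : X ∈ decorations (P.scalars D) (chiOf ω) (Z ∘ ω)) :
    P.E (List.ofFn X).prod ∈ D := by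
  have hprod := prod_mem_normalForms BBSpace.commute_scalars_opposite (fun k => hZ (ω k)) hX
  simp only [normalForms, Set.mem_iUnion, DoubleCoset.mem_doubleCoset, exists_prop] at hprod
  obtain ⟨c, hc, _, ⟨u, hu, u', hu', rfl⟩, _, ⟨_, ⟨a, ha, rfl⟩, _, ⟨b, hb, rfl⟩, rfl⟩, h⟩ := hprod
  have hab : a * b ∈ D := mul_mem ha hb
  change _ = u * u' * _ * (P.L a * P.R b) at h
  rw [h, mul_assoc, mul_assoc]
  refine BBSpace.E_scalar_mul_mem hu (BBSpace.E_scalar_mul_mem hu' ?_)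
  obtain ⟨d, hd⟩ := exists_prod_kappaArg_eq hc hab
  have hκd := hκ d
  rw [hd] at hκd
  -- Under `E` the operator at the right end may be taken from either side. If only one side occurs
  -- in `ω`, an operator of the other side passes to the left end.
  by_cases hmixed : ∃ j, chiOf ω j ≠ chiOf ω 0
  · rw [if_pos hmixed] at hκd
    exact (P.E_mul_L_mul_R (chiOf ω (Fin.last m)) a b _).symm ▸ hκd
  · rw [if_neg hmixed, mul_one] at hκd
    push Not at hmixed
    have hs (k : Fin (m + 1)) : chiOf ω k ≠ (chiOf ω 0).opposite := by
      rw [hmixed k]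
      cases chiOf ω 0 <;> exact Side.noConfusion
    have hC := P.C_mem_scalars (chiOf ω 0).opposite hab
    have hcomm := commute_prod_of_forall_ne BBSpace.commute_scalars_opposite
      (fun k => hZ (ω k)) (fun k => (hc k).1) hs hC
    rw [P.E_mul_L_mul_R (chiOf ω 0).opposite, ← hcomm.eq]
    exact BBSpace.E_scalar_mul_mem hC hκd

theorem E_prod_kappaArg_mem {d : Fin m → D} (hκ : kappa P Z ω (fun i => (d i : B)) ∈ D)
    (hE : ∀ V : Finset (Fin (m + 1)), V.Nonempty → V ≠ Finset.univ →
      ∀ X ∈ decorations (P.scalars D) (chiOf ω) (Z ∘ ω), P.E (orderedProd X V) ∈ D) :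
    P.E (List.ofFn (kappaArg P Z ω fun i => (d i : B))).prod ∈ D := by
  classical
  rw [kappa, cumulant_one_eq] at hκ
  refine (add_mem_cancel_right (sum_mem fun σ hσ => D.smul_mem ?_ _)).1 hκ
  have hσ_ne : σ.1 ≠ ⊤ := fun h => Finset.ne_of_mem_erase hσ (Subtype.ext h)
  exact momentOn_mem (fun X hX V W b hb => insertAtPred_mem_decorations hX V W hb)
    Finset.univ_nonempty (fun V _ hV h => hE V hV fun hV_univ => hσ_ne (h hV_univ))
    (kappaArg_mem_decorations fun i => (d i).2)

theorem E_orderedProd_mem (hZ : ∀ i, ∀ x ∈ P.scalars D (sideOf i).opposite, Commute x (Z i))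
    (hκ : ∀ (m : ℕ) (ω : Fin (m + 1) → I ⊕ J) (d : Fin m → D),
      kappa P Z ω (fun i => (d i : B)) ∈ D)
    {n : ℕ} {ω : Fin n → I ⊕ J} {V : Finset (Fin n)} (hV : V.Nonempty) {X : Fin n → A}
    (hX : X ∈ decorations (P.scalars D) (chiOf ω) (Z ∘ ω)) : P.E (orderedProd X V) ∈ D := by
  induction hcard : V.card using Nat.strong_induction_on generalizing n with
  | _ N ih =>
  obtain ⟨m, rfl⟩ := Nat.exists_eq_succ_of_ne_zero (hcard ▸ hV.card_ne_zero)
  rw [orderedProd_eq_prod_ofFn X hcard]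
  refine E_prod_mem_of_mem_decorations (ω := ω ∘ V.orderEmbOfFin hcard) hZ
    (fun d => E_prod_kappaArg_mem (hκ m _ d) fun U hU hU_ne Y hY => ?_)
    (comp_mem_decorations hX _)
  have hU_card : U.card < m + 1 := by
    simpa using Finset.card_lt_card (Finset.ssubset_univ_iff.2 hU_ne)
  exact ih _ hU_card hU hY rfl

theorem kappaArg_restrict (F : CondExp D) (d : Fin m → D) :
    kappaArg (P.restrict F) Z ω d = kappaArg P Z ω fun i => (d i : B) := by
  funext k
  simp only [kappaArg, BBSpace.restrict_C]

end Kappa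

end BiFree

open BiFree in
theorem mainTheorem7_general {B A I J : Type*} [Ring B] [Algebra ℂ B] [Ring A] [Algebra ℂ A]
    (P : BBSpace B A) (D : Subalgebra ℂ B) (F : CondExp D) (Z : I ⊕ J → A)
    (hZl : ∀ i, Z (.inl i) ∈ (P.restrict F).leftAlgebra)
    (hZr : ∀ j, Z (.inr j) ∈ (P.restrict F).rightAlgebra)
    (hD : ∀ (m : ℕ) (ω : Fin (m + 1) → I ⊕ J) (d : Fin m → D),
      kappa P Z ω (fun k => (d k : B)) ∈ D)
    (m : ℕ) (ω : Fin (m + 1) → I ⊕ J) (d : Fin m → D) :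
    ((kappa (P.restrict F) Z ω d : D) : B) = kappa P Z ω (fun k => (d k : B)) := by
  have hZ (i : I ⊕ J) : ∀ x ∈ P.scalars D (sideOf i).opposite, Commute x (Z i) := by
    cases i with
    | inl i => exact BBSpace.commute_of_mem_leftAlgebra_restrict F (hZl i)
    | inr j => exact BBSpace.commute_of_mem_rightAlgebra_restrict F (hZr j)
  rw [kappa, kappaArg_restrict]
  exact coe_cumulant_restrict F
    (fun X hX V W b hb => insertAtPred_mem_decorations hX V W hb)
    (fun V hV X hX => E_orderedProd_mem hZ hD hV hX) _
    (kappaArg_mem_decorations fun i => (d i).2)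

theorem mainTheorem7 {B A I J : Type*} [Ring B] [Algebra ℂ B] [Ring A] [Algebra ℂ A]
    (P : BiFree.BBSpace B A) (D : Subalgebra ℂ B) (F : BiFree.CondExp D)
    (Zl : I → A) (Zr : J → A)
    (hZl : ∀ i, Zl i ∈ P.leftAlgebra) (hZr : ∀ j, Zr j ∈ P.rightAlgebra)
    (hD : ∀ (m : ℕ) (ω : Fin (m + 1) → I ⊕ J) (d : Fin m → D),
      BiFree.kappa P (Sum.elim Zl Zr) ω (fun k => (d k : B)) ∈ D) :
    ∀ (m : ℕ) (ω : Fin (m + 1) → I ⊕ J) (d : Fin m → D),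
      ((BiFree.kappa (P.restrict F) (Sum.elim Zl Zr) ω d : D) : B) =
        BiFree.kappa P (Sum.elim Zl Zr) ω (fun k => (d k : B)) :=
  mainTheorem7_general P D F _ (fun i => BiFree.BBSpace.leftAlgebra_le_restrict F (hZl i))
    (fun j => BiFree.BBSpace.rightAlgebra_le_restrict F (hZr j)) hD
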